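/- Work in the dagger symmetric monoidal category $\mathrm{fRel}$ of finite sets and relations (composition of relations, converse as dagger, cartesian product as tensor product, unit object $I=\{\star\}$). States $I\to A$ and co-states $A\to I$ are the subsets of $A$, written $|s\rangle$ and $\langle s|=|s\rangle^\dagger$; the scalars are $\{\bot,\top\}$ with $\top=\mathrm{id}_I$. An abelian internal group $\mathbb G=(A,\mathsf X,\mathsf Z)$ in $\mathrm{fRel}$ is a pair of (quasi-)special commutative $\dagger$-Frobenius algebras on a finite set $A$, the group structure $\mathsf X=(\mu_X,\eta_X,\delta_X=\mu_X^\dagger,\epsilon_X=\eta_X^\dagger)$ and the point structure $\mathsf Z=(\mu_Z,\eta_Z,\delta_Z=\mu_Z^\dagger,\epsilon_Z=\eta_Z^\dagger)$, which are strongly complementary: they are coherent ($\delta_Z\eta_X=\eta_X\otimes\eta_X$, $\delta_X\eta_Z=\eta_Z\otimes\eta_Z$, $\epsilon_Z\eta_X=\mathrm{id}_I$) and satisfy the bialgebra equations $\delta_Z\mu_X=(\mu_X\otimes\mu_X)(1\otimes\sigma\otimes1)(\delta_Z\otimes\delta_Z)$, $\delta_Z\eta_X=\eta_X\otimes\eta_X$,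 $\epsilon_Z\mu_X=\epsilon_Z\otimes\epsilon_Z$. The antipode is $S=(1\otimes\epsilon_Z\mu_Z)(\delta_X\eta_X\otimes1)$, and the Fourier transform sends a state $f$ to the co-state $\epsilon_X\,\mu_X\,(1\otimes (S\circ f))$. An abelian groupoid on $A$ is a family $(G_\lambda,+_\lambda,0_\lambda)_{\lambda\in\Lambda}$ of abelian groups whose underlying sets partition $A$. It corresponds to a $\dagger$-Frobenius algebra with multiplication $\mu$ if $\mu\circ(\{a\}\times\{b\})=\{a+_\lambda b\}$ whenever $a,b\in G_\lambda$ for some $\lambda$, and $\mu\circ(\{a\}\times\{b\})=\emptyset$ otherwise. The span $\langle s_j\rangle_{j\in J}$ of a family of subsets $s_j\subseteq A$ is the set of all unions of subfamilies; for a family of pairwise disjoint non-empty subsets, $r\in\langle s_j\rangle_{j\in J}$ is identified with the boolean function $j\mapsto\langle s_j|r\rangle\in\{\bot,\top\}$ on $J$ (and likewise for the co-state $\langle r|$). **Theorem.** Let $\mathbb G=(A,\mathsf X,\mathsf Z)$ be an abelian internal group in $\mathrm{fRel}$. There are finite abelian groups $G$ and $H$, an abelian groupoid $Z=\bigoplus^{|G|}H=(H_g)_{g\in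 G}$ corresponding to $\mathsf Z$ with all $H_g\cong H$, and an abelian groupoid $X=\bigoplus^{|H|}G=(G_h)_{h\in H}$ corresponding to $\mathsf X$ with all $G_h\cong G$. Moreover, for any abelian groupoids $Z=(H_g)_{g\in G}$ and $X=(G_h)_{h\in H}$ (with index sets $G$ and $H$) that correspond to $\mathsf Z$ and $\mathsf X$: 1. $\langle H_g\rangle_{g\in G}\cap\langle G_h\rangle_{h\in H}=\{\emptyset,A\}$. 2. If $A$ has more than one element, then, under the identification of the states in $\langle H_g\rangle_{g\in G}$ with $\{\bot,\top\}^G$ and of the co-states in $\langle G_h\rangle_{h\in H}$ with $\{\bot,\top\}^H$, the Fourier transform of $\mathbb G$ does not restrict to an isomorphism (bijection) $\{\bot,\top\}^G\cong\{\bot,\top\}^H$. 3. For all $S_G\subseteq\{\bot,\top\}^G$ and $S_H\subseteq\{\bot,\top\}^H$, at least one of which contains a non-constant function, the Fourier transform does not restrict, under the same identification, to an isomorphism (bijection) $S_G\cong S_H$. -/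

import Mathlib

/-! The category `fRel` of finite sets and relations: objects are (finite) types, morphisms `A ⟶ B`
are relations `SetRel A B`, composition is `○` (in diagrammatic order), the dagger is the converse
`SetRel.inv`, the tensor product is the cartesian product with unit object `Unit`. -/

universe u v w

namespace FRel

open scoped SetRel

section Category

variable {A B C D : Type*}

/-- The tensor product (parallel composition) of two relations. -/
def tensor (R : SetRel A B) (S : SetRel C D) : SetRel (A × C) (B × D) :=
  {p | (p.1.1, p.2.1) ∈ R ∧ (p.1.2, p.2.2) ∈ S}

/-- A bijection regarded as an isomorphism of `fRel`. -/
def ofEquiv (e : A ≃ B) : SetRel A B := Function.graph e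

/-- The associator. -/
def assoc (A B C : Type*) : SetRel ((A × B) × C) (A × (B × C)) := ofEquiv (Equiv.prodAssoc A B C)

/-- The symmetry. -/
def swap (A B : Type*) : SetRel (A × B) (B × A) := ofEquiv (Equiv.prodComm A B)

/-- The left unitor. -/
def leftUnitor (A : Type*) : SetRel (Unit × A) A := ofEquiv (Equiv.punitProd A)

/-- The right unitor. -/
def rightUnitor (A : Type*) : SetRel (A × Unit) A := ofEquiv (Equiv.prodPUnit A)

/-- The middle-four interchange `(A ⊗ A) ⊗ (A ⊗ A) ⟶ (A ⊗ A) ⊗ (A ⊗ A)` exchanging the second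
and the third factor. -/
def middleSwap (A : Type*) : SetRel ((A × A) × (A × A)) ((A × A) × (A × A)) :=
  ofEquiv (Equiv.prodProdProdComm A A A A)

/-- Scalars are the endomorphisms of the tensor unit. -/
abbrev Scalar : Type := SetRel Unit Unit

/-- Invertibility of a scalar. -/
def IsInvertibleScalar (N : Scalar) : Prop :=
  ∃ M : Scalar, N ○ M = SetRel.id ∧ M ○ N = SetRel.id

/-- Multiplication of a morphism by a scalar. -/
def scalarMul (N : Scalar) (R : SetRel A B) : SetRel A B :=
  (leftUnitor A).inv ○ tensor N R ○ leftUnitor B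

/-- The state `|s⟩ : I ⟶ A` given by the subset `s` of `A`. -/
def ket (s : Set A) : SetRel Unit A := {p | p.2 ∈ s}

/-- The co-state `⟨s| : A ⟶ I`, the dagger of `|s⟩`. -/
def bra (s : Set A) : SetRel A Unit := (ket s).inv

/-- The boolean value of the scalar `⟨s|r⟩`; `⊤` is the identity scalar. -/
def braket (s r : Set A) : Prop := (ket r ○ bra s : Scalar) = SetRel.id

end Category

/-- A quasi-special commutative dagger Frobenius algebra on the object `A` of `fRel`. The comonoid
is the dagger of the monoid. -/
structure DaggerQSCFA (A : Type u) where
  /-- The multiplication. -/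
  mul : SetRel (A × A) A
  /-- The unit. -/
  unit : SetRel Unit A
  mul_assoc : tensor mul SetRel.id ○ mul = assoc A A A ○ tensor SetRel.id mul ○ mul
  unit_mul : tensor unit SetRel.id ○ mul = leftUnitor A
  mul_unit : tensor SetRel.id unit ○ mul = rightUnitor A
  mul_comm : swap A A ○ mul = mul
  frobenius_left : tensor mul.inv SetRel.id ○ assoc A A A ○ tensor SetRel.id mul = mul ○ mul.inv
  frobenius_right :
    tensor SetRel.id mul.inv ○ (assoc A A A).inv ○ tensor mul SetRel.id = mul ○ mul.inv
  quasi_special : ∃ N : Scalar, IsInvertibleScalar N ∧ mul.inv ○ mul = scalarMul N SetRel.id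

namespace DaggerQSCFA

variable {A : Type u}

/-- The comultiplication. -/
def comul (F : DaggerQSCFA A) : SetRel A (A × A) := F.mul.inv

/-- The counit. -/
def counit (F : DaggerQSCFA A) : SetRel A Unit := F.unit.inv

/-- The cup `I ⟶ A ⊗ A`. -/
def cup (F : DaggerQSCFA A) : SetRel Unit (A × A) := F.unit ○ F.comul

/-- The cap `A ⊗ A ⟶ I`. -/
def cap (F : DaggerQSCFA A) : SetRel (A × A) Unit := F.mul ○ F.counit

end DaggerQSCFA

/-- Coherence of two structures: the unit of each of them is copied by the comultiplication of the
other one, and the unit of one followed by the counit of the other one is the identity scalar. -/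
structure Coherent {A : Type u} (Z X : DaggerQSCFA A) : Prop where
  comul_unit : X.unit ○ Z.comul = (leftUnitor Unit).inv ○ tensor X.unit X.unit
  comul_unit' : Z.unit ○ X.comul = (leftUnitor Unit).inv ○ tensor Z.unit Z.unit
  unit_counit : X.unit ○ Z.counit = SetRel.id

/-- Strong complementarity: coherence and the bialgebra equations. -/
structure StronglyComplementary {A : Type u} (Z X : DaggerQSCFA A) : Prop where
  coherent : Coherent Z X
  bialgebra : X.mul ○ Z.comul = tensor Z.comul Z.comul ○ middleSwap A ○ tensor X.mul X.mul
  bialgebra_unit : X.unit ○ Z.comul = (leftUnitor Unit).inv ○ tensor X.unit X.unit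
  bialgebra_counit : X.mul ○ Z.counit = tensor Z.counit Z.counit ○ leftUnitor Unit

/-- An abelian internal group in `fRel` on `A`: a strongly complementary pair consisting of a
commutative group structure `X` and a point structure `Z`. -/
structure AbelianInternalGroup (A : Type u) where
  /-- The group structure. -/
  X : DaggerQSCFA A
  /-- The point structure. -/
  Z : DaggerQSCFA A
  stronglyComplementary : StronglyComplementary Z X

namespace AbelianInternalGroup

variable {A : Type u}

/-- The antipode: the second leg of the cup of `X` is joined with the input by the cap of `Z`;
the output is the first leg of the cup. -/
def antipode (𝔾 : AbelianInternalGroup A) : SetRel A A :=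
  (leftUnitor A).inv ○ tensor 𝔾.X.cup SetRel.id ○ assoc A A A ○ tensor SetRel.id 𝔾.Z.cap ○
    rightUnitor A

/-- The Fourier transform, from states of `A` to co-states of `A`: the antipode is applied to the
state, and the outcome is plugged in the second input of the cap of the group structure. -/
def fourierTransform (𝔾 : AbelianInternalGroup A) (f : SetRel Unit A) : SetRel A Unit :=
  (rightUnitor A).inv ○ tensor SetRel.id (f ○ 𝔾.antipode) ○ 𝔾.X.cap

end AbelianInternalGroup

/-- An abelian groupoid on the set `A`: a family of abelian groups, indexed by `Λ`, whose
underlying sets partition `A`. -/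
structure AbelianGroupoid (Λ : Type v) (A : Type u) where
  /-- The underlying sets of the groups. -/
  part : Λ → Set A
  /-- The group structures. -/
  [addCommGroup : ∀ l, AddCommGroup (part l)]
  partition : ∀ a, ∃! l, a ∈ part l

attribute [instance] AbelianGroupoid.addCommGroup

/-- The groupoid corresponds to the structure `F`: composing `{a} × {b}` with the multiplication of
`F` gives `{a + b}` if `a` and `b` lie in the same group, and `∅` otherwise. -/
def AbelianGroupoid.Corresponds {Λ : Type v} {A : Type u} (Y : AbelianGroupoid Λ A)
    (F : DaggerQSCFA A) : Prop :=
  ∀ a b c : A, ((a, b), c) ∈ F.mul ↔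
    ∃ (l : Λ) (ha : a ∈ Y.part l) (hb : b ∈ Y.part l),
      (((⟨a, ha⟩ : Y.part l) + ⟨b, hb⟩ : Y.part l) : A) = c

section Span

variable {J : Type v} {A : Type u}

/-- The span of a family of states: all unions of subfamilies. -/
def span (s : J → Set A) : Set (Set A) := {r | ∃ I : Set J, r = ⋃ j ∈ I, s j}

/-- The boolean function `j ↦ ⟨s_j|r⟩` on the index set. -/
def toBooleanFunction (s : J → Set A) (r : Set A) : J → Prop := fun j => braket (s j) r

/-- The states in the span of `s` whose boolean function lies in `S`. -/
def statesOf (s : J → Set A) (S : Set (J → Prop)) : Set (Set A) :=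
  {r | r ∈ span s ∧ toBooleanFunction s r ∈ S}

/-- Non-constant boolean functions. -/
def NonConstant (f : J → Prop) : Prop := ∃ i j, f i ≠ f j

end Span

/-- The Fourier transform restricts to an isomorphism `S_G ≅ S_H`, where boolean functions on the
index set of `s` are regarded as states in the span of `s`, and boolean functions on the
index set of `t` as co-states in the span of `t`. -/
def AbelianInternalGroup.FourierRestrictsToIso {A : Type u} (𝔾 : AbelianInternalGroup A)
    {G : Type v} {H : Type w} (s : G → Set A) (t : H → Set A)
    (S_G : Set (G → Prop)) (S_H : Set (H → Prop)) : Prop :=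
  Set.BijOn 𝔾.fourierTransform (ket '' statesOf s S_G) (bra '' statesOf t S_H)

end FRel

/-! A commutative dagger Frobenius algebra in `fRel` is an abelian groupoid, its groups being the
fibres of `source`. Strong complementarity makes the bialgebra law an interchange law
(`exists_corners_iff`), whence every group of `Z` meets every group of `X` in exactly one point
(`exists_source_eq`, `eq_of_source_eq`). With `o` a common identity, the `X`-group of `o` consists
of the `Z`-identities, and conversely; these two groups are `G` and `H`.

A union of `Z`-groups that is also a union of `X`-groups is therefore empty or everything. In the
Fourier transform the `X` cup and cap cancel, leaving inversion in `Z`, which fixes unions of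
`Z`-groups. So a restricted bijection would contain only `∅` and `A`, that is, constant functions.
-/

namespace FRel

open scoped SetRel

/-! ### Frobenius algebras as abelian groupoids. -/

namespace DaggerQSCFA

variable {A : Type u} (F : DaggerQSCFA A) {a b c d m x y u v : A}

/-- The composite of `a` and `b` is `c`. -/
def Composes (a b c : A) : Prop := ((a, b), c) ∈ F.mul

/-- The elements of the unit, which are the identities of the corresponding groupoid. -/
def IsIdentity (a : A) : Prop := ((), a) ∈ F.unit

theorem mem_mul : ((a, b), c) ∈ F.mul ↔ F.Composes a b c := Iff.rfl

theorem mem_comul : (c, (a, b)) ∈ F.comul ↔ F.Composes a b c := Iff.rfl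

theorem mem_unit {i : Unit} : (i, a) ∈ F.unit ↔ F.IsIdentity a := Iff.rfl

theorem mem_counit {i : Unit} : (a, i) ∈ F.counit ↔ F.IsIdentity a := Iff.rfl

variable {F}

theorem Composes.symm (h : F.Composes a b c) : F.Composes b a c := by
  have h' : ((a, b), c) ∈ F.mul := h
  rw [← F.mul_comm] at h'
  simpa [SetRel.mem_comp, swap, ofEquiv, mem_mul] using h'

theorem exists_composes_assoc :
    (∃ m, F.Composes a b m ∧ F.Composes m c d) ↔ ∃ m, F.Composes b c m ∧ F.Composes a m d := by
  have h := Set.ext_iff.1 F.mul_assoc (((a, b), c), d)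
  simpa [SetRel.mem_comp, tensor, assoc, ofEquiv, mem_mul] using h

theorem exists_identity_composes : (∃ u, F.IsIdentity u ∧ F.Composes u a b) ↔ a = b := by
  have h := Set.ext_iff.1 F.unit_mul (((), a), b)
  simpa [SetRel.mem_comp, tensor, leftUnitor, ofEquiv, mem_mul, mem_unit] using h

theorem IsIdentity.eq_of_composes (hu : F.IsIdentity u) (h : F.Composes u a b) : a = b :=
  exists_identity_composes.1 ⟨u, hu, h⟩

/-- The Frobenius law provides division; applied to `u·a = a·u` with `u` the identity at `a`, it
yields inverses. -/
theorem Composes.exists_middle (h : F.Composes a b m) (h' : F.Composes c d m) :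
    ∃ e, F.Composes c e a ∧ F.Composes e b d := by
  have h := (Set.ext_iff.1 F.frobenius_left ((a, b), (c, d))).2 ⟨m, h, h'⟩
  simpa [SetRel.mem_comp, tensor, assoc, ofEquiv, mem_mul] using h

/-- Splitting and then multiplying is a scalar multiple of the identity relation, so a pair cannot
have two distinct outputs. -/
theorem Composes.unique (h : F.Composes a b c) (h' : F.Composes a b d) : c = d := by
  obtain ⟨N, -, hN⟩ := F.quasi_special
  have h := (Set.ext_iff.1 hN (c, d)).1 ⟨(a, b), h, h'⟩
  simp only [scalarMul, tensor, leftUnitor, ofEquiv, SetRel.mem_comp, SetRel.mem_inv,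
    Function.mem_graph, Set.mem_ofPred_eq, SetRel.mem_id] at h
  obtain ⟨⟨⟨⟩, y⟩, ⟨⟨⟨⟩, x⟩, h₁, -, h₂⟩, h₃⟩ := h
  simp_all

variable (F)

theorem exists_source (a : A) : ∃ u, F.IsIdentity u ∧ F.Composes u a a :=
  exists_identity_composes.2 rfl

/-- The identity of the group containing `a`. -/
noncomputable def source (a : A) : A := (F.exists_source a).choose

theorem isIdentity_source (a : A) : F.IsIdentity (F.source a) := (F.exists_source a).choose_spec.1

theorem source_composes (a : A) : F.Composes (F.source a) a a := (F.exists_source a).choose_spec.2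

variable {F}

theorem IsIdentity.source_eq_of_composes (hu : F.IsIdentity u) (h : F.Composes u a b) :
    F.source a = u := by
  obtain rfl := hu.eq_of_composes h
  obtain ⟨w, h₁, -⟩ := exists_composes_assoc.2 ⟨a, F.source_composes a, h⟩
  rw [hu.eq_of_composes h₁, (F.isIdentity_source a).eq_of_composes h₁.symm]

theorem IsIdentity.source_eq (hu : F.IsIdentity u) : F.source u = u := by
  have h := F.source_composes u
  exact hu.eq_of_composes h.symm

theorem Composes.source_eq_left (h : F.Composes a b c) : F.source c = F.source a := by
  obtain ⟨w, h₁, h₂⟩ := exists_composes_assoc.1 ⟨a, F.source_composes a, h⟩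
  obtain rfl := h.unique h₁
  exact (F.isIdentity_source a).source_eq_of_composes h₂

theorem Composes.source_eq_right (h : F.Composes a b c) : F.source c = F.source b :=
  h.symm.source_eq_left

theorem Composes.source_eq (h : F.Composes a b c) : F.source a = F.source b :=
  h.source_eq_left.symm.trans h.source_eq_right

variable (F) in
theorem exists_inverse (a : A) : ∃ b, F.Composes a b (F.source a) := by
  obtain ⟨e, h, -⟩ := (F.source_composes a).exists_middle (F.source_composes a).symm
  exact ⟨e, h⟩

theorem exists_composes_iff : (∃ c, F.Composes a b c) ↔ F.source a = F.source b := by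
  refine ⟨fun ⟨c, h⟩ => h.source_eq, fun h => ?_⟩
  obtain ⟨i, hi⟩ := F.exists_inverse a
  have hb := F.source_composes b
  rw [← h] at hb
  -- Since `(i·a)·b` is defined, with `i` inverse to `a`, associativity forces `a·b` to be defined.
  obtain ⟨c, hc, -⟩ := exists_composes_assoc.1 ⟨_, hi.symm, hb⟩
  exact ⟨c, hc⟩

/-- Left and right inverses of an element coincide. -/
theorem Composes.inverse_unique (h : F.Composes x b u) (hu : F.IsIdentity u)
    (h' : F.Composes b y v) (hv : F.IsIdentity v) : x = y := by
  have huy : F.Composes u y y := by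
    rw [← hu.source_eq, h.source_eq_right, h'.source_eq]
    exact F.source_composes y
  obtain ⟨w, h₁, h₂⟩ := exists_composes_assoc.1 ⟨u, h, huy⟩
  obtain rfl := h'.unique h₁
  exact hv.eq_of_composes h₂.symm

section Group

variable (F)

/-- The underlying set of the group with identity `u`. -/
def fiber (u : A) : Set A := {a | F.source a = u}

variable {F}

theorem exists_composes_fiber (a b : F.fiber u) : ∃ c, F.Composes a b c :=
  exists_composes_iff.2 (a.2.trans b.2.symm)

/-- The sum in a group of the groupoid. -/
noncomputable def fiberAdd (a b : F.fiber u) : F.fiber u :=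
  ⟨(exists_composes_fiber a b).choose,
    (exists_composes_fiber a b).choose_spec.source_eq_left.trans a.2⟩

theorem composes_fiberAdd (a b : F.fiber u) : F.Composes a b (fiberAdd a b) :=
  (exists_composes_fiber a b).choose_spec

/-- The inverse in a group of the groupoid. -/
noncomputable def fiberNeg (a : F.fiber u) : F.fiber u :=
  ⟨(F.exists_inverse a).choose,
    (F.exists_inverse a).choose_spec.source_eq.symm.trans a.2⟩

theorem composes_fiberNeg (a : F.fiber u) : F.Composes a (fiberNeg a) u := by
  have h : F.Composes a (fiberNeg a) (F.source a) := (F.exists_inverse a).choose_spec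
  rwa [show F.source a = u from a.2] at h

/-- The group with identity `u`. -/
noncomputable abbrev fiberAddCommGroup (hu : F.IsIdentity u) : AddCommGroup (F.fiber u) :=
  letI : Add (F.fiber u) := ⟨fiberAdd⟩
  letI : Zero (F.fiber u) := ⟨⟨u, hu.source_eq⟩⟩
  letI : Neg (F.fiber u) := ⟨fiberNeg⟩
  have add_comm' (a b : F.fiber u) : a + b = b + a :=
    Subtype.ext ((composes_fiberAdd a b).unique (composes_fiberAdd b a).symm)
  have zero_add' (a : F.fiber u) : 0 + a = a :=
    Subtype.ext (hu.eq_of_composes (composes_fiberAdd 0 a)).symm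
  have neg_add' (a : F.fiber u) : -a + a = 0 := by
    rw [add_comm']
    exact Subtype.ext ((composes_fiberAdd a (-a)).unique (composes_fiberNeg a))
  have add_assoc' (a b c : F.fiber u) : a + b + c = a + (b + c) := by
    obtain ⟨m, h₁, h₂⟩ := exists_composes_assoc.1
      ⟨_, composes_fiberAdd a b, composes_fiberAdd (a + b) c⟩
    obtain rfl := (composes_fiberAdd b c).unique h₁
    exact Subtype.ext (h₂.unique (composes_fiberAdd a (b + c)))
  { add_assoc := add_assoc'
    zero_add := zero_add'
    add_zero := fun a => (add_comm' a 0).trans (zero_add' a)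
    nsmul := nsmulRec
    zsmul := zsmulRec
    neg_add_cancel := neg_add'
    add_comm := add_comm' }

end Group

/-- The abelian groupoid of a commutative dagger Frobenius algebra, indexed by any set in bijection
with its identities. -/
noncomputable def groupoid (F : DaggerQSCFA A) {Λ : Type v} (e : Λ ≃ {u // F.IsIdentity u}) :
    AbelianGroupoid Λ A where
  part l := F.fiber (e l)
  addCommGroup l := fiberAddCommGroup (e l).2
  partition a := by
    refine ⟨e.symm ⟨F.source a, F.isIdentity_source a⟩, by simp [fiber], fun l hl => ?_⟩
    rw [Equiv.eq_symm_apply]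
    exact Subtype.ext (Eq.symm hl)

theorem groupoid_corresponds (F : DaggerQSCFA A) {Λ : Type v} (e : Λ ≃ {u // F.IsIdentity u}) :
    (F.groupoid e).Corresponds F := by
  intro a b c
  constructor
  · intro h
    have h : F.Composes a b c := h
    obtain ⟨l, hl⟩ := e.surjective ⟨F.source a, F.isIdentity_source a⟩
    have ha : F.source a = e l := by rw [hl]
    have hb : F.source b = e l := by rw [← h.source_eq, ha]
    exact ⟨l, ha, hb, (composes_fiberAdd ⟨a, ha⟩ ⟨b, hb⟩).unique h⟩
  · rintro ⟨l, ha, hb, rfl⟩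
    exact composes_fiberAdd ⟨a, ha⟩ ⟨b, hb⟩

end DaggerQSCFA

/-! ### Groupoids corresponding to a given algebra. -/

namespace AbelianGroupoid

variable {A : Type u} {Λ : Type v} {Y : AbelianGroupoid Λ A} {F : DaggerQSCFA A} {a b : A} {l : Λ}

/-- Composability determines the partition, so statements about arbitrary corresponding groupoids
reduce to `source`. -/
theorem Corresponds.source_eq_iff (h : Y.Corresponds F) (ha : a ∈ Y.part l) :
    F.source a = F.source b ↔ b ∈ Y.part l := by
  rw [← DaggerQSCFA.exists_composes_iff]
  constructor
  · rintro ⟨c, hc⟩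
    obtain ⟨k, ha', hb, -⟩ := (h a b c).1 hc
    rwa [(Y.partition a).unique ha ha']
  · intro hb
    exact ⟨_, (h a b _).2 ⟨l, ha, hb, rfl⟩⟩

theorem part_nonempty (Y : AbelianGroupoid Λ A) (l : Λ) : (Y.part l).Nonempty :=
  ⟨_, (0 : Y.part l).2⟩

theorem mem_iUnion_iff {I : Set Λ} (ha : a ∈ Y.part l) : (a ∈ ⋃ j ∈ I, Y.part j) ↔ l ∈ I := by
  simp only [Set.mem_iUnion]
  constructor
  · rintro ⟨j, hj, haj⟩
    rwa [(Y.partition a).unique ha haj]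
  · exact fun hl => ⟨l, hl, ha⟩

theorem Corresponds.mem_of_mem_span (h : Y.Corresponds F) {r : Set A} (hr : r ∈ span Y.part)
    (ha : a ∈ r) (hab : F.source a = F.source b) : b ∈ r := by
  obtain ⟨I, rfl⟩ := hr
  obtain ⟨l, hl⟩ := (Y.partition a).exists
  rw [mem_iUnion_iff hl] at ha
  exact (mem_iUnion_iff ((h.source_eq_iff hl).1 hab)).2 ha

end AbelianGroupoid

/-! ### Spans and boolean functions. -/

section Span

variable {J : Type v} {A : Type u}

theorem braket_iff {s r : Set A} : braket s r ↔ (s ∩ r).Nonempty := by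
  unfold braket
  rw [Set.ext_iff]
  simp only [Prod.forall, SetRel.mem_comp, SetRel.mem_id, bra, ket, SetRel.mem_inv,
    Set.mem_ofPred_eq, Set.Nonempty, Set.mem_inter_iff]
  exact ⟨fun h => by simpa [and_comm] using (h () ()).2 trivial,
    fun ⟨a, hs, hr⟩ _ _ => ⟨fun _ => trivial, fun _ => ⟨a, hr, hs⟩⟩⟩

theorem empty_mem_span (s : J → Set A) : ∅ ∈ span s := ⟨∅, by simp⟩

theorem AbelianGroupoid.univ_mem_span (Y : AbelianGroupoid J A) : Set.univ ∈ span Y.part := by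
  refine ⟨Set.univ, (Set.eq_univ_of_forall fun a => ?_).symm⟩
  obtain ⟨l, hl⟩ := (Y.partition a).exists
  exact (AbelianGroupoid.mem_iUnion_iff hl).2 trivial

theorem AbelianGroupoid.exists_toBooleanFunction_eq (Y : AbelianGroupoid J A) (f : J → Prop) :
    ∃ r ∈ span Y.part, toBooleanFunction Y.part r = f := by
  refine ⟨_, ⟨{j | f j}, rfl⟩, funext fun j => propext (braket_iff.trans ⟨?_, fun hj => ?_⟩)⟩
  · rintro ⟨a, ha, ha'⟩
    exact (AbelianGroupoid.mem_iUnion_iff ha).1 ha'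
  · obtain ⟨a, ha⟩ := Y.part_nonempty j
    exact ⟨a, ha, (AbelianGroupoid.mem_iUnion_iff ha).2 hj⟩

theorem AbelianGroupoid.not_nonConstant_toBooleanFunction (Y : AbelianGroupoid J A) {r : Set A}
    (hr : r = ∅ ∨ r = Set.univ) : ¬ NonConstant (toBooleanFunction Y.part r) := by
  rintro ⟨i, j, hij⟩
  refine hij (propext ?_)
  rcases hr with rfl | rfl
  · simp [toBooleanFunction, braket_iff]
  · simp [toBooleanFunction, braket_iff, Y.part_nonempty]

theorem bra_injective : Function.Injective (bra : Set A → SetRel A Unit) := fun _ _ h =>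
  Set.ext fun a => Set.ext_iff.1 h (a, ())

end Span

/-! ### Strong complementarity: two transversal groupoids. -/

namespace StronglyComplementary

variable {A : Type u} {Z X : DaggerQSCFA A} {a b c d m g h : A}

theorem exists_isIdentity (hZX : StronglyComplementary Z X) :
    ∃ o, X.IsIdentity o ∧ Z.IsIdentity o := by
  have h := Set.ext_iff.1 hZX.coherent.unit_counit ((), ())
  simpa [SetRel.mem_comp, DaggerQSCFA.mem_unit, DaggerQSCFA.mem_counit] using h

theorem exists_isIdentity_composes (hZX : StronglyComplementary Z X) :
    (∃ c, X.IsIdentity c ∧ Z.Composes a b c) ↔ X.IsIdentity a ∧ X.IsIdentity b := by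
  have h := Set.ext_iff.1 hZX.coherent.comul_unit ((), (a, b))
  simpa [SetRel.mem_comp, DaggerQSCFA.mem_unit, DaggerQSCFA.mem_comul, leftUnitor, ofEquiv,
    tensor] using h

/-- Interchange: the corners form a 2×2 matrix whose rows `Z`-compose to `a`, `b` and whose columns
`X`-compose to `c`, `d`. -/
theorem exists_corners_iff (hZX : StronglyComplementary Z X) :
    (∃ m, X.Composes a b m ∧ Z.Composes c d m) ↔
      ∃ a₁ a₂ b₁ b₂, Z.Composes a₁ a₂ a ∧ Z.Composes b₁ b₂ b ∧
        X.Composes a₁ b₁ c ∧ X.Composes a₂ b₂ d := by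
  have h := Set.ext_iff.1 hZX.bialgebra ((a, b), (c, d))
  simp only [SetRel.mem_comp, DaggerQSCFA.mem_mul, DaggerQSCFA.mem_comul, middleSwap, ofEquiv,
    tensor, Function.mem_graph, Set.mem_ofPred_eq, Prod.exists, Equiv.prodProdProdComm_apply,
    Prod.mk.injEq] at h
  rw [h]
  constructor
  · rintro ⟨p, q, r, s, ⟨a₁, a₂, b₁, b₂, ⟨h₁, h₂⟩, ⟨rfl, rfl⟩, rfl, rfl⟩, h₃, h₄⟩
    exact ⟨_, _, _, _, h₁, h₂, h₃, h₄⟩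
  · rintro ⟨a₁, a₂, b₁, b₂, h₁, h₂, h₃, h₄⟩
    exact ⟨_, _, _, _, ⟨a₁, a₂, b₁, b₂, ⟨h₁, h₂⟩, ⟨rfl, rfl⟩, rfl, rfl⟩, h₃, h₄⟩

/-- Strong complementarity is symmetric. -/
theorem symm (hZX : StronglyComplementary Z X) : StronglyComplementary X Z where
  coherent :=
    { comul_unit := hZX.coherent.comul_unit'
      comul_unit' := hZX.coherent.comul_unit
      unit_counit := by
        obtain ⟨o, h₁, h₂⟩ := hZX.exists_isIdentity
        ext ⟨⟨⟩, ⟨⟩⟩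
        exact ⟨fun _ => rfl, fun _ => ⟨o, h₂, h₁⟩⟩ }
  bialgebra := by
    ext ⟨⟨a, b⟩, ⟨c, d⟩⟩
    simp only [SetRel.mem_comp, DaggerQSCFA.mem_mul, DaggerQSCFA.mem_comul, middleSwap, ofEquiv,
      tensor, Function.mem_graph, Set.mem_ofPred_eq, Prod.exists, Equiv.prodProdProdComm_apply,
      Prod.mk.injEq]
    -- Exchanging `Z` and `X` transposes the matrix of corners.
    simp only [and_comm (a := Z.Composes a b _), hZX.exists_corners_iff]
    constructor
    · rintro ⟨a₁, a₂, b₁, b₂, h₁, h₂, h₃, h₄⟩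
      exact ⟨_, _, _, _, ⟨_, _, _, _, ⟨h₃, h₄⟩, ⟨rfl, rfl⟩, rfl, rfl⟩, h₁, h₂⟩
    · rintro ⟨p, q, r, s, ⟨a₁, a₂, b₁, b₂, ⟨h₁, h₂⟩, ⟨rfl, rfl⟩, rfl, rfl⟩, h₃, h₄⟩
      exact ⟨_, _, _, _, h₃, h₄, h₁, h₂⟩
  bialgebra_unit := hZX.coherent.comul_unit'
  bialgebra_counit := by
    ext ⟨⟨a, b⟩, ⟨⟩⟩
    have h := hZX.exists_isIdentity_composes (a := a) (b := b)
    simpa [SetRel.mem_comp, DaggerQSCFA.mem_mul, DaggerQSCFA.mem_counit, leftUnitor, ofEquiv,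
      tensor, and_comm] using h

/-- The identities of `X` form one of the groups of `Z`. -/
theorem source_eq_iff_isIdentity (hZX : StronglyComplementary Z X) {o : A} (hX : X.IsIdentity o)
    (hZ : Z.IsIdentity o) : Z.source a = o ↔ X.IsIdentity a := by
  constructor
  · rintro rfl
    obtain ⟨b, hb⟩ := Z.exists_inverse a
    exact (hZX.exists_isIdentity_composes.1 ⟨_, hX, hb⟩).1
  · intro ha
    obtain ⟨c, -, hc⟩ := hZX.exists_isIdentity_composes.2 ⟨ha, hX⟩
    rw [hc.source_eq, hZ.source_eq]

/-- Passing to the identity for `Z` is a functor for the groupoid of `X`. -/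
theorem composes_source (hZX : StronglyComplementary Z X) (h : X.Composes a b m) :
    X.Composes (Z.source a) (Z.source b) (Z.source m) := by
  -- Writing `m` as `m` times its `Z`-identity makes the second column compose to a `Z`-identity, so
  -- `a₂` and `b₂` are the `Z`-identities of `a` and `b`.
  obtain ⟨a₁, a₂, b₁, b₂, h₁, h₂, -, h₄⟩ :=
    hZX.exists_corners_iff.1 ⟨m, h, (Z.source_composes m).symm⟩
  obtain ⟨ha, hb⟩ := hZX.symm.exists_isIdentity_composes.1 ⟨_, Z.isIdentity_source m, h₄⟩
  rwa [h₁.source_eq_right, h₂.source_eq_right, ha.source_eq, hb.source_eq]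

/-- A group of `Z` and a group of `X` intersect. -/
theorem exists_source_eq (hZX : StronglyComplementary Z X) (hg : Z.IsIdentity g)
    (hh : X.IsIdentity h) : ∃ a, Z.source a = g ∧ X.source a = h := by
  obtain ⟨o, hX, hZ⟩ := hZX.exists_isIdentity
  obtain ⟨g', hg'⟩ := X.exists_inverse g
  obtain ⟨h', hh'⟩ := Z.exists_inverse h
  rw [(hZX.symm.source_eq_iff_isIdentity hZ hX).2 hg] at hg'
  rw [(hZX.source_eq_iff_isIdentity hX hZ).2 hh] at hh'
  -- Both `g·g'` in `X` and `h·h'` in `Z` equal `o`; the corner `a₁` lies in the row of `g` and the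
  -- column of `h`.
  obtain ⟨a₁, a₂, b₁, b₂, h₁, -, h₃, -⟩ := hZX.exists_corners_iff.1 ⟨o, hg', hh'⟩
  exact ⟨a₁, by rw [← h₁.source_eq_left, hg.source_eq],
    by rw [← h₃.source_eq_left, hh.source_eq]⟩

/-- A group of `Z` and a group of `X` have at most one common element. -/
theorem eq_of_source_eq (hZX : StronglyComplementary Z X) (h₁ : Z.source a = Z.source b)
    (h₂ : X.source a = X.source b) : a = b := by
  obtain ⟨o, hX, hZ⟩ := hZX.exists_isIdentity
  obtain ⟨i, hi⟩ := X.exists_inverse b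
  -- The quotient `c = a·b⁻¹` in `X` has `Z`-identity `o`, hence is an `X`-identity.
  obtain ⟨c, hc⟩ := DaggerQSCFA.exists_composes_iff.2 (h₂.trans hi.source_eq)
  have hc' := hZX.composes_source hc
  rw [h₁] at hc'
  have hco : Z.source c = o := by
    rw [hc'.unique (hZX.composes_source hi)]
    exact (hZX.source_eq_iff_isIdentity hX hZ).2 (X.isIdentity_source b)
  exact hc.inverse_unique ((hZX.source_eq_iff_isIdentity hX hZ).1 hco) hi.symm
    (X.isIdentity_source b)

/-- Any group of `X` is isomorphic to the one formed by the identities of `Z`. -/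
theorem nonempty_fiber_addEquiv (hZX : StronglyComplementary Z X) {o : A} (hX : X.IsIdentity o)
    (hZ : Z.IsIdentity o) (hh : X.IsIdentity h) :
    letI := DaggerQSCFA.fiberAddCommGroup hh
    letI := DaggerQSCFA.fiberAddCommGroup hX
    Nonempty (X.fiber h ≃+ X.fiber o) := by
  let := DaggerQSCFA.fiberAddCommGroup hh
  let := DaggerQSCFA.fiberAddCommGroup hX
  have hmem (a : A) : Z.source a ∈ X.fiber o :=
    (hZX.symm.source_eq_iff_isIdentity hZ hX).2 (Z.isIdentity_source a)
  -- The isomorphism sends `a` to its `Z`-identity; transversality makes it bijective.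
  let φ : X.fiber h →+ X.fiber o := AddMonoidHom.mk' (fun a => ⟨Z.source a, hmem a⟩) fun a b =>
    Subtype.ext ((hZX.composes_source (DaggerQSCFA.composes_fiberAdd a b)).unique
      (DaggerQSCFA.composes_fiberAdd ⟨Z.source a, hmem a⟩ ⟨Z.source b, hmem b⟩))
  refine ⟨AddEquiv.ofBijective φ ⟨fun a b hab => ?_, fun g => ?_⟩⟩
  · exact Subtype.ext (hZX.eq_of_source_eq (congrArg Subtype.val hab) (a.2.trans b.2.symm))
  · obtain ⟨a, h₁, h₂⟩ :=
      hZX.exists_source_eq ((hZX.symm.source_eq_iff_isIdentity hZ hX).1 g.2) hh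
    exact ⟨⟨a, h₂⟩, Subtype.ext h₁⟩

variable {G : Type v} {H : Type w} {Y : AbelianGroupoid G A} {W : AbelianGroupoid H A}

/-- A nonempty member contains a whole `Z`-group, which meets every `X`-group. -/
theorem span_inter_span (hZX : StronglyComplementary Z X) (hY : Y.Corresponds Z)
    (hW : W.Corresponds X) : span Y.part ∩ span W.part = {∅, Set.univ} := by
  apply Set.Subset.antisymm
  · rintro r ⟨hr, hr'⟩
    rcases r.eq_empty_or_nonempty with rfl | ⟨a, ha⟩
    · exact Or.inl rfl
    refine Or.inr (Set.eq_univ_of_forall fun b => ?_)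
    obtain ⟨c, h₁, h₂⟩ := hZX.exists_source_eq (Z.isIdentity_source a) (X.isIdentity_source b)
    exact hW.mem_of_mem_span hr' (hY.mem_of_mem_span hr ha h₁.symm) h₂
  · rintro r (rfl | rfl)
    · exact ⟨empty_mem_span _, empty_mem_span _⟩
    · exact ⟨Y.univ_mem_span, W.univ_mem_span⟩

theorem exists_nonConstant [Nontrivial A] (hZX : StronglyComplementary Z X)
    (hY : Y.Corresponds Z) (hW : W.Corresponds X) :
    (∃ f : G → Prop, NonConstant f) ∨ ∃ f : H → Prop, NonConstant f := by
  obtain ⟨a, b, hab⟩ := exists_pair_ne A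
  obtain ⟨i, hi⟩ := (Y.partition a).exists
  obtain ⟨j, hj⟩ := (Y.partition b).exists
  by_cases hij : i = j
  · obtain ⟨k, hk⟩ := (W.partition a).exists
    obtain ⟨l, hl⟩ := (W.partition b).exists
    refine Or.inr ?_
    have hkl : k ≠ l := by
      rintro rfl
      subst hij
      exact hab (hZX.eq_of_source_eq ((hY.source_eq_iff hi).2 hj) ((hW.source_eq_iff hk).2 hl))
    exact ⟨(· = k), k, l, by simpa using hkl.symm⟩
  · exact Or.inl ⟨(· = i), i, j, by simpa using Ne.symm hij⟩

end StronglyComplementary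

/-! ### The Fourier transform. -/

namespace AbelianInternalGroup

variable {A : Type u} (𝔾 : AbelianInternalGroup A) {a b x : A}

theorem mem_antipode : (a, b) ∈ 𝔾.antipode ↔
    ∃ y, (∃ c, 𝔾.X.IsIdentity c ∧ 𝔾.X.Composes b y c) ∧
      ∃ d, 𝔾.Z.Composes y a d ∧ 𝔾.Z.IsIdentity d := by
  simp [antipode, SetRel.mem_comp, leftUnitor, rightUnitor, assoc, tensor, ofEquiv,
    DaggerQSCFA.cup, DaggerQSCFA.cap, DaggerQSCFA.mem_unit, DaggerQSCFA.mem_counit,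
    DaggerQSCFA.mem_mul, DaggerQSCFA.mem_comul]

/-- The cup of `X` in the antipode cancels the final cap of `X`, by uniqueness of inverses. -/
theorem mem_fourierTransform {r : Set A} : (x, ()) ∈ 𝔾.fourierTransform (ket r) ↔
    ∃ a ∈ r, ∃ d, 𝔾.Z.Composes x a d ∧ 𝔾.Z.IsIdentity d := by
  have h : (x, ()) ∈ 𝔾.fourierTransform (ket r) ↔ ∃ b, (∃ a ∈ r, (a, b) ∈ 𝔾.antipode) ∧
      ∃ c, 𝔾.X.Composes x b c ∧ 𝔾.X.IsIdentity c := by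
    simp [fourierTransform, SetRel.mem_comp, rightUnitor, tensor, ofEquiv, ket,
      DaggerQSCFA.cap, DaggerQSCFA.mem_counit, DaggerQSCFA.mem_mul]
  rw [h]
  constructor
  · rintro ⟨b, ⟨a, ha, hab⟩, c, hc, hc'⟩
    obtain ⟨y, ⟨e, he, he'⟩, hd⟩ := 𝔾.mem_antipode.1 hab
    obtain rfl := hc.inverse_unique hc' he' he
    exact ⟨a, ha, hd⟩
  · rintro ⟨a, ha, hd⟩
    obtain ⟨b, hb⟩ := 𝔾.X.exists_inverse x
    have hx := 𝔾.X.isIdentity_source x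
    exact ⟨b, ⟨a, ha, 𝔾.mem_antipode.2 ⟨x, ⟨_, hx, hb.symm⟩, hd⟩⟩, _, hb, hx⟩

variable {𝔾} {G : Type v} {H : Type w} {Z : AbelianGroupoid G A} {X : AbelianGroupoid H A}

/-- The Fourier transform sends a union of groups of the point structure to its dagger. -/
theorem fourierTransform_ket (hZ : Z.Corresponds 𝔾.Z) {r : Set A} (hr : r ∈ span Z.part) :
    𝔾.fourierTransform (ket r) = bra r := by
  ext ⟨x, ⟨⟩⟩
  rw [mem_fourierTransform]
  change _ ↔ x ∈ r
  constructor
  · rintro ⟨a, ha, d, hd, -⟩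
    exact hZ.mem_of_mem_span hr ha hd.source_eq.symm
  · intro hx
    obtain ⟨a, ha⟩ := 𝔾.Z.exists_inverse x
    exact ⟨a, hZ.mem_of_mem_span hr hx ha.source_eq, _, ha, 𝔾.Z.isIdentity_source x⟩

theorem not_fourierRestrictsToIso (hZ : Z.Corresponds 𝔾.Z) (hX : X.Corresponds 𝔾.X)
    {S_G : Set (G → Prop)} {S_H : Set (H → Prop)}
    (hS : (∃ f ∈ S_G, NonConstant f) ∨ (∃ f ∈ S_H, NonConstant f)) :
    ¬ 𝔾.FourierRestrictsToIso Z.part X.part S_G S_H := by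
  intro hF
  have hspan {r : Set A} (h₁ : r ∈ span Z.part) (h₂ : r ∈ span X.part) :
      r = ∅ ∨ r = Set.univ := by
    have h : r ∈ span Z.part ∩ span X.part := ⟨h₁, h₂⟩
    rwa [𝔾.stronglyComplementary.span_inter_span hZ hX] at h
  rcases hS with ⟨f, hf, hc⟩ | ⟨f, hf, hc⟩
  · obtain ⟨r, hr, rfl⟩ := Z.exists_toBooleanFunction_eq f
    obtain ⟨t, ⟨ht, -⟩, htr⟩ := hF.mapsTo ⟨r, ⟨hr, hf⟩, rfl⟩
    rw [fourierTransform_ket hZ hr] at htr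
    obtain rfl := bra_injective htr
    exact Z.not_nonConstant_toBooleanFunction (hspan hr ht) hc
  -- A non-constant function in `S_H` is excluded by surjectivity: its preimage would be the same
  -- subset, in both spans.
  · obtain ⟨r, hr, rfl⟩ := X.exists_toBooleanFunction_eq f
    obtain ⟨_, ⟨t, ⟨ht, -⟩, rfl⟩, htr⟩ := hF.surjOn ⟨r, ⟨hr, hf⟩, rfl⟩
    rw [fourierTransform_ket hZ ht] at htr
    obtain rfl := bra_injective htr
    exact X.not_nonConstant_toBooleanFunction (hspan ht hr) hc

variable (𝔾) in
theorem exists_groupoids :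
    ∃ (G : Type u) (H : Type u) (_ : AddCommGroup G) (_ : AddCommGroup H)
      (Z : AbelianGroupoid G A) (X : AbelianGroupoid H A),
      Z.Corresponds 𝔾.Z ∧ X.Corresponds 𝔾.X ∧
      (∀ g, Nonempty (Z.part g ≃+ H)) ∧ (∀ h, Nonempty (X.part h ≃+ G)) := by
  have hZX := 𝔾.stronglyComplementary
  obtain ⟨o, hX, hZ⟩ := hZX.exists_isIdentity
  let eG : 𝔾.X.fiber o ≃ {u // 𝔾.Z.IsIdentity u} :=
    Equiv.subtypeEquivRight fun a => hZX.symm.source_eq_iff_isIdentity hZ hX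
  let eH : 𝔾.Z.fiber o ≃ {u // 𝔾.X.IsIdentity u} :=
    Equiv.subtypeEquivRight fun a => hZX.source_eq_iff_isIdentity hX hZ
  exact ⟨𝔾.X.fiber o, 𝔾.Z.fiber o, DaggerQSCFA.fiberAddCommGroup hX,
    DaggerQSCFA.fiberAddCommGroup hZ, 𝔾.Z.groupoid eG, 𝔾.X.groupoid eH,
    𝔾.Z.groupoid_corresponds eG, 𝔾.X.groupoid_corresponds eH,
    fun g => hZX.symm.nonempty_fiber_addEquiv hZ hX (eG g).2,
    fun h => hZX.nonempty_fiber_addEquiv hX hZ (eH h).2⟩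

end AbelianInternalGroup

end FRel

theorem mainTheorem9 {A : Type u} [Finite A] (𝔾 : FRel.AbelianInternalGroup A) :
    -- the groupoids `Z = ⊕^|G| H` and `X = ⊕^|H| G` exist
    (∃ (G : Type u) (H : Type u) (_ : AddCommGroup G) (_ : AddCommGroup H)
        (Z : FRel.AbelianGroupoid G A) (X : FRel.AbelianGroupoid H A),
        Z.Corresponds 𝔾.Z ∧ X.Corresponds 𝔾.X ∧
        (∀ g, Nonempty (Z.part g ≃+ H)) ∧ (∀ h, Nonempty (X.part h ≃+ G))) ∧
    -- and for all corresponding groupoids: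
    ∀ (G : Type v) (H : Type w) (Z : FRel.AbelianGroupoid G A) (X : FRel.AbelianGroupoid H A),
      Z.Corresponds 𝔾.Z → X.Corresponds 𝔾.X →
        FRel.span Z.part ∩ FRel.span X.part = {∅, Set.univ} ∧
        (Nontrivial A →
          ¬ 𝔾.FourierRestrictsToIso Z.part X.part Set.univ Set.univ) ∧
        ∀ (S_G : Set (G → Prop)) (S_H : Set (H → Prop)),
          ((∃ f ∈ S_G, FRel.NonConstant f) ∨ (∃ f ∈ S_H, FRel.NonConstant f)) →
            ¬ 𝔾.FourierRestrictsToIso Z.part X.part S_G S_H := by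
  refine ⟨𝔾.exists_groupoids, fun G H Z X hZ hX =>
    ⟨𝔾.stronglyComplementary.span_inter_span hZ hX, fun _ => ?_, fun S_G S_H hS =>
      FRel.AbelianInternalGroup.not_fourierRestrictsToIso hZ hX hS⟩⟩
  refine FRel.AbelianInternalGroup.not_fourierRestrictsToIso hZ hX ?_
  simpa using 𝔾.stronglyComplementary.exists_nonConstant hZ hX
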